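/- Let $a\ge 2$ be an integer and let $\alpha\in\mathbb{C}\setminus\mathbb{R}$ be a non-real root of $x^3-ax^2+x-1$. Let $(G_n)_{n\ge 0}$ be given by $G_0=1$, $G_1=a$, $G_2=a^2-1$ and $G_{n+3}=aG_{n+2}-G_{n+1}+G_n$ for $n\ge 0$. A word $(d_i)_{2\le i\le N}$ of non-negative integers is called a greedy $G$-expansion if it is, up to leading zeros, the output of the greedy algorithm with weights $G_0<G_1<\cdots$ applied to $\sum_{i=2}^{N}d_iG_{i-2}$; that is, if $\sum_{i=2}^{k}d_iG_{i-2}<G_{k-1}$ for every $2\le k\le N$. Define the $G$-Rauzy fractal $$\mathcal{G}_a=\Big\{\sum_{i=2}^{\infty}d_i\alpha^i \;:\; (d_i)_{2\le i\le N}\text{ is a greedy }G\text{-expansion for every }N\ge 2\Big\}.$$ Then $\mathcal{G}_a$ induces a periodic tiling of the complex plane, that is: (a) $\mathbb{C}=\bigcup_{u\in\mathbb{Z}+\mathbb{Z}\alpha}(\mathcal{G}_a+u)$; (b) if $u,v\in\mathbb{Z}+\mathbb{Z}\alpha$ and $\operatorname{int}(\mathcal{G}_a+u)\cap(\mathcal{G}_a+v)\ne\emptyset$,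 then $u=v$. -/

import Mathlib

/-- The sequence `G₀ = 1`, `G₁ = a`, `G₂ = a² - 1`, `Gₙ₊₃ = a Gₙ₊₂ - Gₙ₊₁ + Gₙ`. -/
def seqG (a : ℤ) : ℕ → ℤ
  | 0 => 1
  | 1 => a
  | 2 => a ^ 2 - 1
  | n + 3 => a * seqG a (n + 2) - seqG a (n + 1) + seqG a n

/-- The word `(ε₀, …, ε_N)` of natural numbers is a greedy `w`-expansion, that is, the word that
the greedy algorithm with weights `w₀ < w₁ < …` returns for the number `∑_{i ≤ N} εᵢ wᵢ`, with
leading zeros allowed: at every stage the part that remains to be expanded with `w₀, …, w_k` is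
smaller than the next weight `w_{k+1}`. Only the entries `ε₀, …, ε_N` matter. -/
def IsGreedyExpansion (w : ℕ → ℤ) (N : ℕ) (ε : ℕ → ℕ) : Prop :=
  ∀ k ≤ N, ∑ i ∈ Finset.range (k + 1), (ε i : ℤ) * w i < w (k + 1)

/-- The `G`-Rauzy fractal: all sums `∑_{i ≥ 2} dᵢ αⁱ` such that every initial word
`(d₂, …, d_{N+2})` is a greedy `G`-expansion. Here `ε i` is the digit `d_{i+2}`, whose weight in
the greedy expansion is `Gᵢ`. -/
def gRauzyFractal (a : ℤ) (α : ℂ) : Set ℂ :=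
  {z | ∃ ε : ℕ → ℕ, (∀ N, IsGreedyExpansion (seqG a) N ε) ∧
    HasSum (fun i : ℕ => (ε i : ℂ) * α ^ (i + 2)) z}

/-- The group `ℤ + ℤα`. -/
def latticeZα (α : ℂ) : Set ℂ :=
  {u | ∃ m n : ℤ, u = (m : ℂ) + (n : ℂ) * α}

/-- The translate `S + u` of a set of complex numbers. -/
def translateBy (S : Set ℂ) (u : ℂ) : Set ℂ :=
  (fun z => z + u) '' S

open Filter Topology

/-! ### The sequence `G` -/

/-! Modulo `ℤ + ℤα` one has `α ^ (k + 2) ≡ G_k α²`, so a finite greedy expansion of `n` is a point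
of the tile congruent to `n α²`. The points `n α² + m + l α` with `n ≥ 0` are dense, and the tiles
form a locally finite family of compact sets; this gives the covering. For (b), an interior point of
one tile lying in another is a limit of truncated expansions, so some finite expansion `s` satisfies
`s ∈ 𝒢 + (u - v)`. By `digits_finite_of_hasSum`, the expansion of `s - (u - v)` is finite and
expands the same `n` as `s`; uniqueness of greedy expansions gives `u = v`. That lemma follows the
remainders of the expansion in `ℤ[α]`. Their values at `α` and at the real root `β` are bounded,
hence so are their integer coordinates. Greediness then confines a linear form in the coordinates to
`[0, 1]` from some index on, and `eq_zero_of_remainder_mem_Icc` makes the coordinates vanish. -/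

theorem seqG_add_three (a : ℤ) (n : ℕ) :
    seqG a (n + 3) = a * seqG a (n + 2) - seqG a (n + 1) + seqG a n := rfl

theorem seqG_pos_and_lt {a : ℤ} (ha : 2 ≤ a) (n : ℕ) :
    0 < seqG a n ∧ seqG a n < seqG a (n + 1) ∧ seqG a (n + 1) < seqG a (n + 2) ∧
      seqG a (n + 2) < seqG a (n + 3) := by
  induction n with
  | zero =>
    simp only [seqG]
    refine ⟨?_, ?_, ?_, ?_⟩ <;>
      nlinarith [mul_nonneg (by linarith : 0 ≤ a - 2) (by nlinarith : 0 ≤ a ^ 2)]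
  | succ n ih =>
    obtain ⟨h0, h1, h2, h3⟩ := ih
    refine ⟨by linarith, h2, h3, ?_⟩
    have e3 := seqG_add_three a n
    have e4 := seqG_add_three a (n + 1)
    rw [show n + 1 + 3 = n + 4 from rfl, show n + 1 + 2 = n + 3 from rfl,
      show n + 1 + 1 = n + 2 from rfl] at *
    nlinarith [mul_nonneg (by linarith : 0 ≤ a - 2)
      (by linarith : 0 ≤ seqG a (n + 3) + seqG a (n + 2))]

theorem seqG_pos {a : ℤ} (ha : 2 ≤ a) (n : ℕ) : 0 < seqG a n := (seqG_pos_and_lt ha n).1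

theorem strictMono_seqG {a : ℤ} (ha : 2 ≤ a) : StrictMono (seqG a) :=
  strictMono_nat_of_lt_succ fun n => (seqG_pos_and_lt ha n).2.1

theorem natCast_lt_seqG {a : ℤ} (ha : 2 ≤ a) (n : ℕ) : (n : ℤ) < seqG a n := by
  induction n with
  | zero => simp [seqG]
  | succ n ih => have := strictMono_seqG ha (lt_add_one n); push_cast; omega

theorem seqG_succ_le {a : ℤ} (ha : 2 ≤ a) (n : ℕ) : seqG a (n + 1) ≤ a * seqG a n := by
  match n with
  | 0 => simp [seqG]
  | 1 => simp only [seqG]; nlinarith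
  | n + 2 =>
    rw [seqG_add_three]
    have := (seqG_pos_and_lt ha n).2.1
    linarith

/-! ### Greedy expansions -/

theorem IsGreedyExpansion.digit_lt {a : ℤ} (ha : 2 ≤ a) {ε : ℕ → ℕ} {k : ℕ}
    (h : IsGreedyExpansion (seqG a) k ε) : (ε k : ℤ) < a := by
  have h1 := h k le_rfl
  rw [Finset.sum_range_succ] at h1
  have h2 : 0 ≤ ∑ i ∈ Finset.range k, (ε i : ℤ) * seqG a i :=
    Finset.sum_nonneg fun i _ => mul_nonneg (by positivity) (seqG_pos ha i).le
  have h3 := seqG_succ_le ha k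
  have := seqG_pos ha k
  by_contra! h4
  nlinarith

theorem isGreedyExpansion_forall_iff {w : ℕ → ℤ} (h0 : 0 < w 0) {ε : ℕ → ℕ} :
    (∀ N, IsGreedyExpansion w N ε) ↔
      ∀ k, ∑ i ∈ Finset.range k, (ε i : ℤ) * w i < w k := by
  constructor
  · rintro h (_ | k)
    · simpa using h0
    · exact h k k le_rfl
  · intro h N k _
    exact h (k + 1)

theorem exists_greedy {w : ℕ → ℤ} (h0 : w 0 = 1) (hw : StrictMono w) (k : ℕ) :
    ∀ n : ℤ, 0 ≤ n → n < w k → ∃ ε : ℕ → ℕ, (∀ N, IsGreedyExpansion w N ε) ∧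
      (∀ i, k ≤ i → ε i = 0) ∧ ∑ i ∈ Finset.range k, (ε i : ℤ) * w i = n := by
  have hpos : ∀ i, 0 < w i := fun i => by
    have := hw.monotone (Nat.zero_le i); omega
  induction k with
  | zero =>
    intro n hn hn'
    refine ⟨0, ?_, by simp, by simp; omega⟩
    rw [isGreedyExpansion_forall_iff (hpos 0)]
    intro k; simpa using hpos k
  | succ k ih =>
    intro n hn hn'
    obtain ⟨ε, hε, hz, hs⟩ := ih (n % w k) (Int.emod_nonneg _ (hpos k).ne')
      (Int.emod_lt_of_pos _ (hpos k))
    have hd : 0 ≤ n / w k := Int.ediv_nonneg hn (hpos k).le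
    have hlow : ∀ j ≤ k, ∑ i ∈ Finset.range j, (Function.update ε k (n / w k).toNat i : ℤ) * w i
        = ∑ i ∈ Finset.range j, (ε i : ℤ) * w i := by
      intro j hj
      refine Finset.sum_congr rfl fun i hi => ?_
      rw [Function.update_of_ne]
      have := Finset.mem_range.1 hi; omega
    have htop : ∑ i ∈ Finset.range (k + 1), (Function.update ε k (n / w k).toNat i : ℤ) * w i
        = n := by
      rw [Finset.sum_range_succ, hlow k le_rfl, hs, Function.update_self, Int.toNat_of_nonneg hd]
      have := Int.emod_add_mul_ediv n (w k)
      linarith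
    have hzero : ∀ i, k + 1 ≤ i → Function.update ε k (n / w k).toNat i = 0 := by
      intro i hi
      rw [Function.update_of_ne (by omega)]
      exact hz i (by omega)
    refine ⟨Function.update ε k (n / w k).toNat, ?_, hzero, htop⟩
    rw [isGreedyExpansion_forall_iff (hpos 0)] at hε ⊢
    intro j
    rcases le_or_gt j k with hj | hj
    · rw [hlow j hj]; exact hε j
    · rw [← Finset.sum_subset (Finset.range_subset_range.2 (show k + 1 ≤ j from hj)), htop]
      · exact hn'.trans_le (hw.monotone hj)
      · intro i _ hi
        rw [hzero i (by simpa using hi)]; simp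

/-- Both lower parts lie in `[0, w k)`, so the top digit is the quotient by `w k`; descend. -/
theorem greedy_unique {w : ℕ → ℤ} {ε δ : ℕ → ℕ}
    (hε : ∀ k, ∑ i ∈ Finset.range k, (ε i : ℤ) * w i < w k)
    (hδ : ∀ k, ∑ i ∈ Finset.range k, (δ i : ℤ) * w i < w k) (hw : ∀ k, 0 < w k) (k : ℕ)
    (h : ∑ i ∈ Finset.range k, (ε i : ℤ) * w i = ∑ i ∈ Finset.range k, (δ i : ℤ) * w i) :
    ∀ i < k, ε i = δ i := by
  induction k with
  | zero => simp
  | succ k ih =>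
    have h0 : ∀ η : ℕ → ℕ, 0 ≤ ∑ i ∈ Finset.range k, (η i : ℤ) * w i := fun η =>
      Finset.sum_nonneg fun i _ => mul_nonneg (by positivity) (hw i).le
    rw [Finset.sum_range_succ, Finset.sum_range_succ] at h
    have hk : (ε k : ℤ) = δ k := by
      have h1 := hε k; have h2 := hδ k; have h3 := h0 ε; have h4 := h0 δ; have h5 := hw k
      rcases lt_trichotomy (ε k : ℤ) (δ k) with h6 | h6 | h6
      · nlinarith
      · exact h6
      · nlinarith
    intro i hi
    rcases (Nat.lt_succ_iff_lt_or_eq.1 hi) with hi | rfl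
    · exact ih (by rw [hk] at h; linarith) i hi
    · exact_mod_cast hk

theorem greedy_truncate {w : ℕ → ℤ} (hw : StrictMono w) (h0 : 0 < w 0) {ε : ℕ → ℕ}
    (hε : ∀ k, ∑ i ∈ Finset.range k, (ε i : ℤ) * w i < w k) (N k : ℕ) :
    ∑ i ∈ Finset.range k, ((if i < N then ε i else 0 : ℕ) : ℤ) * w i < w k := by
  refine lt_of_le_of_lt (Finset.sum_le_sum fun i _ => ?_) (hε k)
  have : 0 < w i := h0.trans_le (hw.monotone (Nat.zero_le i))
  split_ifs
  · exact le_rfl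
  · simpa using mul_nonneg (Nat.cast_nonneg (ε i)) this.le

/-! ### Bounded integer solutions of the remainder inequality -/

/-- The form is `x k - t (1 - t) x (k + 1) + t x (k + 2)`. Evaluating it where `x` attains its
maximum `M` and its minimum `m` leaves few values of `M`, which are excluded in turn; `hno` is
needed because the pattern `1, 0, 0` gives exactly the value `1`. -/
theorem eq_zero_of_remainder_mem_Icc {t : ℝ} (ht0 : 0 < t) (ht1 : t ≤ 4 / 7) {x : ℕ → ℤ} {B : ℤ}
    (hB : ∀ k, |x k| ≤ B)
    (hlow : ∀ k, 0 ≤ (x k : ℝ) + t * (x (k + 2) - x (k + 1)) + t ^ 2 * x (k + 1))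
    (hupp : ∀ k, (x k : ℝ) + t * (x (k + 2) - x (k + 1)) + t ^ 2 * x (k + 1) ≤ 1)
    (hno : ∀ k, x k = 1 → x (k + 1) = 0 → x (k + 2) ≠ 0) (k : ℕ) : x k = 0 := by
  obtain ⟨M, ⟨kM, hkM⟩, hM⟩ := Int.exists_greatest_of_bdd (P := fun z => ∃ k, x k = z)
    ⟨B, by rintro z ⟨k, rfl⟩; exact (abs_le.1 (hB k)).2⟩ ⟨x 0, 0, rfl⟩
  obtain ⟨m, ⟨km, hkm⟩, hm⟩ := Int.exists_least_of_bdd (P := fun z => ∃ k, x k = z)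
    ⟨-B, by rintro z ⟨k, rfl⟩; exact (abs_le.1 (hB k)).1⟩ ⟨x 0, 0, rfl⟩
  have hxM : ∀ k, x k ≤ M := fun k => hM _ ⟨k, rfl⟩
  have hxm : ∀ k, m ≤ x k := fun k => hm _ ⟨k, rfl⟩
  have hxM' : ∀ k, (x k : ℝ) ≤ M := fun k => by exact_mod_cast hxM k
  have hxm' : ∀ k, (m : ℝ) ≤ x k := fun k => by exact_mod_cast hxm k
  have hs : 0 < t * (1 - t) := by nlinarith
  have h1 : -(t * M) ≤ m * (1 - t + t ^ 2) := by
    have := hlow km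
    rw [hkm] at this
    nlinarith [mul_le_mul_of_nonneg_left (hxm' (km + 1)) hs.le,
      mul_le_mul_of_nonneg_left (hxM' (km + 2)) ht0.le]
  have h2 : M * (1 - t + t ^ 2) ≤ 1 - t * m := by
    have := hupp kM
    rw [hkM] at this
    nlinarith [mul_le_mul_of_nonneg_left (hxM' (kM + 1)) hs.le,
      mul_le_mul_of_nonneg_left (hxm' (kM + 2)) ht0.le]
  have hmM : 0 < M → -M < m := by
    intro h
    by_contra! h3
    have h3' : (m : ℝ) ≤ -M := by exact_mod_cast h3
    have h' : (0 : ℝ) < M := by exact_mod_cast h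
    nlinarith [mul_le_mul_of_nonneg_right h3' (by nlinarith : 0 ≤ 1 - t + t ^ 2),
      mul_pos h' (by nlinarith : 0 < (1 - t) ^ 2)]
  have hM2 : M ≤ 2 := by
    by_contra! h
    have h3 : (-M + 1 : ℝ) ≤ m := by exact_mod_cast hmM (by omega)
    have h4 : (3 : ℝ) ≤ M := by exact_mod_cast h
    -- Hence `M ≤ 1 / (1 - t) ≤ 7 / 3`, by `t ≤ 4 / 7`.
    have h5 : M * (1 - t) ^ 2 ≤ 1 - t := by nlinarith
    nlinarith
  have hM1 : M ≤ 1 := by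
    by_contra! h
    obtain rfl : M = 2 := by omega
    have hm1 : -1 ≤ m := by have := hmM (by omega); omega
    have key : ∀ k, x k = 2 → x (k + 1) = 2 ∧ x (k + 2) < 0 := by
      intro k hk
      have hu := hupp k
      rw [hk] at hu
      push_cast at hu
      have e1 := hxM' (k + 1)
      push_cast at e1
      constructor
      · by_contra hne
        have e2 : (x (k + 1) : ℝ) ≤ 1 := by
          have := hxM (k + 1); exact_mod_cast (by omega : x (k + 1) ≤ 1)
        have e3 : (-1 : ℝ) ≤ x (k + 2) := by exact_mod_cast hm1.trans (hxm (k + 2))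
        nlinarith [mul_le_mul_of_nonneg_left e2 hs.le, mul_le_mul_of_nonneg_left e3 ht0.le]
      · by_contra! hge
        have e3 : (0 : ℝ) ≤ x (k + 2) := by exact_mod_cast hge
        nlinarith [mul_le_mul_of_nonneg_left e1 hs.le, mul_nonneg ht0.le e3,
          sq_nonneg (2 * t - 1)]
    have h3 := key kM hkM
    have h4 := key (kM + 1) h3.1
    have := h4.1
    rw [show kM + 1 + 1 = kM + 2 from rfl] at this
    omega
  have hM0 : M ≤ 0 := by
    by_contra! h
    obtain rfl : M = 1 := by omega
    have hm0 : 0 ≤ m := by have := hmM (by omega); omega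
    have key : ∀ k, x k = 1 → x (k + 2) = 0 := by
      intro k hk
      by_contra hne
      have hu := hupp k
      have e3 : (1 : ℝ) ≤ x (k + 2) := by
        have := hxm (k + 2); exact_mod_cast (by omega : 1 ≤ x (k + 2))
      have e1 := hxM' (k + 1)
      rw [hk] at hu
      push_cast at hu e1
      nlinarith [mul_le_mul_of_nonneg_left e1 hs.le, mul_le_mul_of_nonneg_left e3 ht0.le]
    have e2 := key kM hkM
    -- Either way `1, 0, 0` occurs, starting at `kM` or at `kM + 1`.
    rcases (by have := hxM (kM + 1); have := hxm (kM + 1); omega :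
      x (kM + 1) = 0 ∨ x (kM + 1) = 1) with h0 | h0
    · exact hno kM hkM h0 e2
    · exact hno (kM + 1) h0 e2 (key (kM + 1) h0)
  have hm0 : 0 ≤ m := by
    by_contra! h
    have h' : (m : ℝ) ≤ -1 := by exact_mod_cast (by omega : m ≤ -1)
    have h'' : (M : ℝ) ≤ 0 := by exact_mod_cast hM0
    nlinarith [mul_le_mul_of_nonneg_right h' (by nlinarith : 0 ≤ 1 - t + t ^ 2)]
  have := hxM k
  have := hxm k
  omega

/-! ### The roots of `x³ - a x² + x - 1` -/

/-- By Vieta the third root is `β = a - 2 Re α`. From `a ≥ 2` one gets `β (β - 1)² ≥ 1`, whereas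
`7/4 · (3/4)² = 63/64 < 1`. -/
theorem conjugate_root_facts {a : ℤ} (ha : 2 ≤ a) {α : ℂ}
    (hroot : α ^ 3 - (a : ℂ) * α ^ 2 + α - 1 = 0) (hα : α.im ≠ 0) :
    ∃ β : ℝ, 7 / 4 ≤ β ∧ β ^ 3 - a * β ^ 2 + β - 1 = 0 ∧ Complex.normSq α * β = 1 ∧
      β = a - 2 * α.re := by
  have hre := congrArg Complex.re hroot
  have him := congrArg Complex.im hroot
  simp only [pow_succ, pow_zero, one_mul, Complex.sub_re, Complex.add_re, Complex.mul_re,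
    Complex.mul_im, Complex.sub_im, Complex.add_im, Complex.intCast_re, Complex.intCast_im,
    Complex.one_re, Complex.one_im, Complex.zero_re, Complex.zero_im] at hre him
  set s := α.re
  set q := α.im
  have him' : 3 * s ^ 2 - q ^ 2 - 2 * a * s + 1 = 0 := by
    have : q * (3 * s ^ 2 - q ^ 2 - 2 * a * s + 1) = 0 := by linear_combination him
    exact (mul_eq_zero.1 this).resolve_left hα
  have hN : Complex.normSq α * (a - 2 * s) = 1 := by
    rw [Complex.normSq_apply]
    linear_combination hre - s * him'
  have hf : ((a : ℝ) - 2 * s) ^ 3 - a * (a - 2 * s) ^ 2 + (a - 2 * s) - 1 = 0 := by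
    rw [Complex.normSq_apply] at hN
    linear_combination hN + (a - 2 * s) * him'
  have ha' : (2 : ℝ) ≤ a := by exact_mod_cast ha
  have hpos : 0 < (a : ℝ) - 2 * s := by
    by_contra! h
    nlinarith [Complex.normSq_nonneg α]
  refine ⟨a - 2 * s, ?_, hf, hN, rfl⟩
  generalize (a : ℝ) - 2 * s = β at *
  have h1 : 1 ≤ β := by
    by_contra! h
    nlinarith [mul_pos hpos hpos]
  by_contra! h
  have h2 : 1 ≤ β * (β - 1) ^ 2 := by nlinarith [mul_pos hpos hpos]
  nlinarith [mul_nonneg (sub_nonneg.2 h1) (sub_nonneg.2 h.le), mul_pos hpos hpos]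

theorem norm_root_lt_one {a : ℤ} (ha : 2 ≤ a) {α : ℂ}
    (hroot : α ^ 3 - (a : ℂ) * α ^ 2 + α - 1 = 0) (hα : α.im ≠ 0) : ‖α‖ < 1 := by
  obtain ⟨β, hβ, -, hN, -⟩ := conjugate_root_facts ha hroot hα
  rw [Complex.normSq_eq_norm_sq] at hN
  by_contra! h
  nlinarith

theorem exists_pow_eq_lattice_add {a : ℤ} {α : ℂ}
    (hroot : α ^ 3 - (a : ℂ) * α ^ 2 + α - 1 = 0) (k : ℕ) :
    ∃ m l : ℤ, α ^ (k + 2) = m + l * α + seqG a k * α ^ 2 := by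
  suffices h : ∀ k, (∃ m l : ℤ, α ^ (k + 2) = m + l * α + seqG a k * α ^ 2) ∧
      (∃ m l : ℤ, α ^ (k + 1 + 2) = m + l * α + seqG a (k + 1) * α ^ 2) ∧
      (∃ m l : ℤ, α ^ (k + 2 + 2) = m + l * α + seqG a (k + 2) * α ^ 2) from (h k).1
  intro k
  induction k with
  | zero =>
    simp only [seqG]
    refine ⟨⟨0, 0, by simp⟩, ⟨1, -1, ?_⟩, ⟨a, 1 - a, ?_⟩⟩ <;> push_cast
    · linear_combination hroot
    · linear_combination (α + a) * hroot
  | succ k ih =>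
    obtain ⟨⟨m0, l0, h0⟩, ⟨m1, l1, h1⟩, ⟨m2, l2, h2⟩⟩ := ih
    refine ⟨⟨m1, l1, h1⟩, ⟨m2, l2, h2⟩, a * m2 - m1 + m0, a * l2 - l1 + l0, ?_⟩
    rw [show k + 1 + 2 = k + 3 from rfl, seqG_add_three]
    push_cast
    linear_combination α ^ (k + 2) * hroot + a * h2 - h1 + h0

theorem norm_le_of_hasSum {a : ℤ} {α z : ℂ} (h1 : ‖α‖ < 1) {δ : ℕ → ℕ}
    (hδ : ∀ i, (δ i : ℤ) < a) (h : HasSum (fun i => (δ i : ℂ) * α ^ (i + 2)) z) :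
    ‖z‖ ≤ a * (1 - ‖α‖)⁻¹ := by
  rw [← h.tsum_eq]
  refine tsum_of_norm_bounded ((hasSum_geometric_of_lt_one (norm_nonneg α) h1).mul_left (a : ℝ))
    fun i => ?_
  rw [norm_mul, norm_pow, Complex.norm_natCast]
  have h2 : (δ i : ℝ) ≤ a := by exact_mod_cast (hδ i).le
  gcongr ?_ * ?_
  · exact (Nat.cast_nonneg _).trans h2
  · exact pow_le_pow_of_le_one (norm_nonneg α) h1.le (by omega)

/-- The combination `E` removes the modes `β` and `c = conj α`, so `E (k + 1) = α * E k` and `E` is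
bounded. As `E k = (G_{k+2} - β G_{k+1}) - c (G_{k+1} - β G_k)`, its imaginary part is `Im α *
(G_{k+1} - β G_k)`. -/
theorem seqG_succ_sub_bounded {a : ℤ} {α : ℂ}
    (hroot : α ^ 3 - (a : ℂ) * α ^ 2 + α - 1 = 0) (hα : α.im ≠ 0) (h1 : ‖α‖ < 1) {β : ℝ}
    (hN : Complex.normSq α * β = 1) (hβ : β = a - 2 * α.re) :
    ∃ C, ∀ k, |(seqG a (k + 1) : ℝ) - β * seqG a k| ≤ C := by
  set c := (starRingEnd ℂ) α with hc
  have hsum : α + c = ((2 * α.re : ℝ) : ℂ) := Complex.add_conj α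
  have hprod : α * c = ((Complex.normSq α : ℝ) : ℂ) := Complex.mul_conj α
  have hβC : (β : ℂ) + α + c = a := by
    rw [add_assoc, hsum, hβ]; push_cast; ring
  have hNC : α * c * β = 1 := by rw [hprod]; exact_mod_cast hN
  have h0 : α ≠ 0 := by rintro rfl; simp at hα
  have hpair : α * (β + c) + β * c = 1 := by
    have : α * (α * (β + c) + β * c - 1) = 0 := by
      linear_combination -hroot + (α ^ 2) * hβC + hNC
    have := (mul_eq_zero.1 this).resolve_left h0
    linear_combination this
  let E : ℕ → ℂ := fun k => seqG a (k + 2) - (β + c) * seqG a (k + 1) + β * c * seqG a k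
  have hE : ∀ k, ‖E k‖ ≤ ‖E 0‖ := by
    intro k
    induction k with
    | zero => exact le_rfl
    | succ k ih =>
      have : E (k + 1) = α * E k := by
        simp only [E, show k + 1 + 2 = k + 3 from rfl, show k + 1 + 1 = k + 2 from rfl,
          seqG_add_three]
        push_cast
        linear_combination (-(seqG a (k + 2)) : ℂ) * hβC + (seqG a (k + 1) : ℂ) * hpair
          - (seqG a k : ℂ) * hNC
      rw [this, norm_mul]
      exact (mul_le_of_le_one_left (norm_nonneg _) h1.le).trans ih
  refine ⟨‖E 0‖ / |α.im|, fun k => ?_⟩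
  rw [le_div_iff₀ (abs_pos.2 hα), ← abs_mul]
  refine le_trans (le_of_eq ?_) ((Complex.abs_im_le_norm (E k)).trans (hE k))
  congr 1
  simp [E, c]
  ring

/-! ### The integer remainders of an expansion -/

/-- The integer coordinates of the successive remainders of an expansion with digits `ε`. -/
def remainderSeq (a : ℤ) (ε : ℕ → ℕ) (x₀ x₁ x₂ : ℤ) : ℕ → ℤ
  | 0 => x₀
  | 1 => x₁
  | 2 => x₂
  | k + 3 => remainderSeq a ε x₀ x₁ x₂ (k + 2) - a * remainderSeq a ε x₀ x₁ x₂ (k + 1)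
      + remainderSeq a ε x₀ x₁ x₂ k + ε k

/-- The remainder with coordinates `x k, x (k + 1), x (k + 2)`, evaluated at `γ`. -/
def remainderEval {R : Type*} [CommRing R] (x : ℕ → ℤ) (γ : R) (k : ℕ) : R :=
  γ ^ 2 * x k + γ * (x (k + 2) - x (k + 1)) + x (k + 1)

/-- Since `1/γ = γ² - aγ + 1`, division by `γ` turns the constant coefficient into the leading one;
this is why a single sequence `x` encodes all three coordinates. -/
theorem mul_remainderEval_succ {R : Type*} [CommRing R] {a : ℤ} {γ : R}
    (hγ : γ ^ 3 - a * γ ^ 2 + γ - 1 = 0) {x : ℕ → ℤ} {ε : ℕ → ℕ}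
    (hx : ∀ k, x (k + 3) = x (k + 2) - a * x (k + 1) + x k + ε k) (k : ℕ) :
    γ * remainderEval x γ (k + 1) = remainderEval x γ k + ε k * γ ^ 2 := by
  simp only [remainderEval, show k + 1 + 2 = k + 3 from rfl, show k + 1 + 1 = k + 2 from rfl, hx]
  push_cast
  linear_combination (x (k + 1) : R) * hγ

/-- Writing `r_k` for the remainder at `α`, this is the `α²`-coordinate of `α^k r_k = r_0 + ∑_{i<k}
ε_i α^(i+2)`, with `k + 2` in place of `k` so that no index is negative. -/
theorem sum_digits_eq_remainder {a : ℤ} {x : ℕ → ℤ} {ε : ℕ → ℕ}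
    (hx : ∀ k, x (k + 3) = x (k + 2) - a * x (k + 1) + x k + ε k) (k : ℕ) :
    ∑ i ∈ Finset.range (k + 2), (ε i : ℤ) * seqG a i + x 0 =
      x (k + 2) * seqG a (k + 2) + (x (k + 4) - x (k + 3)) * seqG a (k + 1)
        + x (k + 3) * seqG a k := by
  induction k with
  | zero =>
    have h3 := hx 0
    have h4 := hx 1
    simp only [Finset.sum_range_succ, seqG] at *
    norm_num at *
    rw [h4, h3]
    ring
  | succ k ih =>
    have h5 := hx (k + 2)
    rw [Finset.sum_range_succ]
    simp only [show k + 1 + 2 = k + 3 from rfl, show k + 1 + 3 = k + 4 from rfl,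
      show k + 1 + 4 = k + 5 from rfl, show k + 1 + 1 = k + 2 from rfl,
      seqG_add_three] at *
    rw [h5]
    linear_combination ih

/-- Each step divides by `β > 1`; `a β² / (β - 1)` is the fixed point of `r ↦ (r + a β²) / β`. -/
theorem remainderEval_real_bounded {a : ℤ} {β : ℝ} (h1 : 1 < β)
    (hβ : β ^ 3 - a * β ^ 2 + β - 1 = 0) {x : ℕ → ℤ} {ε : ℕ → ℕ} (hε : ∀ i, (ε i : ℤ) < a)
    (hx : ∀ k, x (k + 3) = x (k + 2) - a * x (k + 1) + x k + ε k) :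
    ∃ C, ∀ k, |remainderEval x β k| ≤ C := by
  have hε' : ∀ i, (ε i : ℝ) ≤ a := fun i => by exact_mod_cast (hε i).le
  have hb : 0 < β - 1 := by linarith
  have ha0 : (0 : ℝ) ≤ a := (Nat.cast_nonneg _).trans (hε' 0)
  refine ⟨|remainderEval x β 0| + a * β ^ 2 / (β - 1), fun k => ?_⟩
  induction k with
  | zero => have : 0 ≤ a * β ^ 2 / (β - 1) := by positivity
            linarith
  | succ k ih =>
    have h := mul_remainderEval_succ hβ hx k
    set C := a * β ^ 2 / (β - 1) with hC
    have hC' : C * (β - 1) = a * β ^ 2 := by rw [hC]; field_simp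
    have h2 : β * |remainderEval x β (k + 1)| ≤ |remainderEval x β k| + a * β ^ 2 := by
      rw [← abs_of_pos (by linarith : 0 < β), ← abs_mul, abs_of_pos (by linarith : 0 < β), h]
      refine (abs_add_le _ _).trans ?_
      rw [abs_of_nonneg (by positivity : 0 ≤ (ε k : ℝ) * β ^ 2)]
      gcongr
      exact hε' k
    have h3 := abs_nonneg (remainderEval x β 0)
    by_contra! h4
    nlinarith

theorem hasSum_remainderEval {a : ℤ} {α : ℂ} (hroot : α ^ 3 - (a : ℂ) * α ^ 2 + α - 1 = 0)
    (h0 : α ≠ 0) {x : ℕ → ℤ} {ε : ℕ → ℕ}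
    (hx : ∀ k, x (k + 3) = x (k + 2) - a * x (k + 1) + x k + ε k)
    (h : HasSum (fun i => (ε i : ℂ) * α ^ (i + 2)) (-remainderEval x α 0)) (k : ℕ) :
    HasSum (fun i => (ε (i + k) : ℂ) * α ^ (i + 2)) (-remainderEval x α k) := by
  induction k with
  | zero => exact h
  | succ k ih =>
    have h1 := ((hasSum_nat_add_iff' 1).2 ih).mul_left α⁻¹
    have h2 := mul_remainderEval_succ hroot hx k
    have e1 : -remainderEval x α (k + 1) = α⁻¹ * (-remainderEval x α k
        - ∑ i ∈ Finset.range 1, (ε (i + k) : ℂ) * α ^ (i + 2)) := by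
      simp only [Finset.sum_range_one, zero_add]
      field_simp
      linear_combination -h2
    rw [e1]
    refine h1.congr_fun fun i => ?_
    rw [show i + (k + 1) = i + 1 + k by ring]
    field_simp
    ring

theorem coord_bounded_of_remainderEval_bounded {α : ℂ} (hα : α.im ≠ 0) {β C₁ C₂ : ℝ}
    {x : ℕ → ℤ} (h₁ : ∀ k, |remainderEval x β k| ≤ C₁) (h₂ : ∀ k, ‖remainderEval x α k‖ ≤ C₂) :
    ∃ B : ℤ, ∀ k, |x k| ≤ B := by
  set s := α.re with hs
  set q := α.im with hq
  have hd : 0 < (β - s) ^ 2 + q ^ 2 := by positivity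
  refine ⟨⌈(C₁ + C₂ + |β - s| * (C₂ / |q|)) / ((β - s) ^ 2 + q ^ 2)⌉, fun k => ?_⟩
  -- The leading coefficient of a real quadratic, recovered from its values at `β` and `α`. The
  -- other coordinates are shifts of the same sequence.
  have key : ((β - s) ^ 2 + q ^ 2) * x k = remainderEval x β k - (remainderEval x α k).re
      - (β - s) * ((remainderEval x α k).im / q) := by
    have e1 : (remainderEval x α k).re =
        (s ^ 2 - q ^ 2) * x k + s * (x (k + 2) - x (k + 1)) + x (k + 1) := by
      simp [remainderEval, pow_two, ← hs, ← hq]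
    have e2 : (remainderEval x α k).im = 2 * s * q * x k + q * (x (k + 2) - x (k + 1)) := by
      simp [remainderEval, pow_two, ← hs, ← hq, -mul_eq_mul_right_iff]
      ring
    rw [e1, e2, remainderEval]
    field_simp
    ring
  have hb : ((β - s) ^ 2 + q ^ 2) * |(x k : ℝ)| ≤ C₁ + C₂ + |β - s| * (C₂ / |q|) := by
    rw [show ((β - s) ^ 2 + q ^ 2) * |(x k : ℝ)| = |((β - s) ^ 2 + q ^ 2) * x k| by
      rw [abs_mul, abs_of_pos hd], key]
    refine (abs_sub _ _).trans (add_le_add ((abs_sub _ _).trans (add_le_add (h₁ k) ?_)) ?_)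
    · exact (Complex.abs_re_le_norm _).trans (h₂ k)
    · rw [abs_mul, abs_div]
      gcongr
      exact (Complex.abs_im_le_norm _).trans (h₂ k)
  have : |(x k : ℝ)| ≤ ⌈(C₁ + C₂ + |β - s| * (C₂ / |q|)) / ((β - s) ^ 2 + q ^ 2)⌉ := by
    refine le_trans ?_ (Int.le_ceil _)
    rw [le_div_iff₀ hd]
    linarith
  exact_mod_cast this

/-- Divide `sum_digits_eq_remainder` by `G_k`: up to an error `O(1 / G_k)` the form is a greedy sum,
shifted by `x 0`, over `G_k`. Bounded integer coordinates give the form finitely many values, so the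
error finally disappears. -/
theorem eventually_remainder_mem_Icc {a : ℤ} (ha : 2 ≤ a) {β t C : ℝ} (ht : t * β = 1)
    (hC : ∀ k, |(seqG a (k + 1) : ℝ) - β * seqG a k| ≤ C) {x : ℕ → ℤ} {ε : ℕ → ℕ}
    (hx : ∀ k, x (k + 3) = x (k + 2) - a * x (k + 1) + x k + ε k)
    (hε : ∀ k, ∑ i ∈ Finset.range k, (ε i : ℤ) * seqG a i < seqG a k)
    (hx0 : x 0 ≤ 0) {B : ℤ} (hB : ∀ k, |x k| ≤ B) :
    ∀ᶠ k in atTop, 0 ≤ (x k : ℝ) + t * (x (k + 2) - x (k + 1)) + t ^ 2 * x (k + 1) ∧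
      (x k : ℝ) + t * (x (k + 2) - x (k + 1)) + t ^ 2 * x (k + 1) ≤ 1 := by
  let g : ℤ × ℤ × ℤ → ℝ := fun p => p.1 + t * (p.2.2 - p.2.1) + t ^ 2 * p.2.1
  let I : Set ℤ := Set.Icc (-B) B
  have hfin : (g '' (I ×ˢ I ×ˢ I)).Finite :=
    ((Set.finite_Icc _ _).prod ((Set.finite_Icc _ _).prod (Set.finite_Icc _ _))).image g
  have hmem : ∀ k, g (x k, x (k + 1), x (k + 2)) ∈ g '' (I ×ˢ I ×ˢ I) := fun k =>
    ⟨_, ⟨abs_le.1 (hB k), abs_le.1 (hB (k + 1)), abs_le.1 (hB (k + 2))⟩, rfl⟩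
  have hB' : ∀ k, |(x k : ℝ)| ≤ B := fun k => by exact_mod_cast hB k
  have hC0 : 0 ≤ C := (abs_nonneg _).trans (hC 0)
  have hB0 : (0 : ℝ) ≤ B := (abs_nonneg _).trans (hB' 0)
  obtain ⟨D, hD⟩ : ∃ D : ℝ, ∀ k, -D ≤ seqG a (k + 2) * g (x (k + 2), x (k + 3), x (k + 4)) ∧
      seqG a (k + 2) * g (x (k + 2), x (k + 3), x (k + 4)) ≤ seqG a (k + 2) + D := by
    refine ⟨-x 0 + (B + B) * (|t| * C) + B * (t ^ 2 * C + |t| * C), fun k => ?_⟩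
    have hS : ∑ i ∈ Finset.range (k + 2), (ε i : ℝ) * seqG a i + x 0 =
        x (k + 2) * seqG a (k + 2) + (x (k + 4) - x (k + 3)) * seqG a (k + 1)
        + x (k + 3) * seqG a k := by exact_mod_cast sum_digits_eq_remainder hx k
    have hS0 : 0 ≤ ∑ i ∈ Finset.range (k + 2), (ε i : ℝ) * seqG a i :=
      Finset.sum_nonneg fun i _ => mul_nonneg (by positivity)
        (by exact_mod_cast (seqG_pos ha i).le)
    have hS1 : ∑ i ∈ Finset.range (k + 2), (ε i : ℝ) * seqG a i < seqG a (k + 2) := by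
      exact_mod_cast hε (k + 2)
    have hx0' : (x 0 : ℝ) ≤ 0 := by exact_mod_cast hx0
    have hdiff : seqG a (k + 2) * g (x (k + 2), x (k + 3), x (k + 4)) -
        (∑ i ∈ Finset.range (k + 2), (ε i : ℝ) * seqG a i + x 0) =
        (x (k + 4) - x (k + 3)) * (t * (seqG a (k + 2) - β * seqG a (k + 1))) + x (k + 3) *
        (t ^ 2 * (seqG a (k + 2) - β * seqG a (k + 1))
          + t * (seqG a (k + 1) - β * seqG a k)) := by
      rw [hS]
      simp only [g]
      linear_combination ((x (k + 4) - x (k + 3)) * seqG a (k + 1) + x (k + 3) * seqG a k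
        + x (k + 3) * t * seqG a (k + 1) : ℝ) * ht
    have h1 : |((x (k + 4) : ℝ) - x (k + 3)) * (t * (seqG a (k + 2) - β * seqG a (k + 1)))|
        ≤ (B + B) * (|t| * C) := by
      rw [abs_mul, abs_mul]
      gcongr
      · exact (abs_sub _ _).trans (add_le_add (hB' _) (hB' _))
      · exact hC (k + 1)
    have h2 : |(x (k + 3) : ℝ) * (t ^ 2 * (seqG a (k + 2) - β * seqG a (k + 1))
        + t * (seqG a (k + 1) - β * seqG a k))| ≤ B * (t ^ 2 * C + |t| * C) := by
      rw [abs_mul]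
      gcongr
      · exact hB' _
      · refine (abs_add_le _ _).trans ?_
        rw [abs_mul, abs_mul, abs_of_nonneg (sq_nonneg t)]
        gcongr
        · exact hC (k + 1)
        · exact hC k
    have h3 := abs_le.1 h1
    have h4 := abs_le.1 h2
    constructor <;> linarith [h3.1, h3.2, h4.1, h4.2]
  have hG : Tendsto (fun k => (seqG a k : ℝ)) atTop atTop :=
    tendsto_atTop_mono (fun k => by exact_mod_cast (natCast_lt_seqG ha k).le)
      tendsto_natCast_atTop_atTop
  have hev : ∀ᶠ k in atTop, ∀ f ∈ g '' (I ×ˢ I ×ˢ I),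
      (f < 0 → D < seqG a k * (-f)) ∧ (1 < f → D < seqG a k * (f - 1)) := by
    rw [eventually_all_finite hfin]
    intro f _
    refine Eventually.and ?_ ?_
    · by_cases hf : f < 0
      · filter_upwards [(hG.atTop_mul_const (neg_pos.2 hf)).eventually_gt_atTop D] with k hk _
        exact hk
      · simp [hf]
    · by_cases hf : 1 < f
      · filter_upwards [(hG.atTop_mul_const (sub_pos.2 hf)).eventually_gt_atTop D] with k hk _
        exact hk
      · simp [hf]
  filter_upwards [hev, eventually_ge_atTop 2] with k hk hk2
  obtain ⟨j, rfl⟩ := Nat.exists_eq_add_of_le' hk2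
  have h1 := hk _ (hmem (j + 2))
  have h2 := hD j
  change 0 ≤ g (x (j + 2), x (j + 3), x (j + 4)) ∧ g (x (j + 2), x (j + 3), x (j + 4)) ≤ 1
  constructor <;> by_contra! h3
  · have := h1.1 h3; linarith
  · have := h1.2 h3; linarith

/-- A point `n α² + u` with `0 ≤ n` and `u` in the lattice has only finite expansions, and these
expand the number `n`. -/
theorem digits_finite_of_hasSum {a : ℤ} (ha : 2 ≤ a) {α : ℂ}
    (hroot : α ^ 3 - (a : ℂ) * α ^ 2 + α - 1 = 0) (hα : α.im ≠ 0) {ε : ℕ → ℕ}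
    (hε : ∀ N, IsGreedyExpansion (seqG a) N ε) {n m l : ℤ} (hn : 0 ≤ n)
    (h : HasSum (fun i => (ε i : ℂ) * α ^ (i + 2)) (n * α ^ 2 - m - l * α)) :
    ∃ K, (∀ k, K ≤ k → ε k = 0) ∧ ∑ i ∈ Finset.range K, (ε i : ℤ) * seqG a i = n := by
  obtain ⟨β, hβ, hβroot, hN, hβα⟩ := conjugate_root_facts ha hroot hα
  have h1 := norm_root_lt_one ha hroot hα
  have h0 : α ≠ 0 := by rintro rfl; simp at hα
  have hdig : ∀ i, (ε i : ℤ) < a := fun i => (hε i).digit_lt ha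
  have hgr := (isGreedyExpansion_forall_iff (seqG_pos ha 0)).1 hε
  -- The initial remainder is `-n α² + l α + m`, the negative of the expanded point.
  let x := remainderSeq a ε (-n) m (m + l)
  have hx : ∀ k, x (k + 3) = x (k + 2) - a * x (k + 1) + x k + ε k := fun k => rfl
  have hx0 : x 0 = -n := rfl
  have hsum : HasSum (fun i => (ε i : ℂ) * α ^ (i + 2)) (-remainderEval x α 0) := by
    convert h using 1
    simp only [remainderEval, x, remainderSeq]
    push_cast
    ring
  obtain ⟨C₁, hC₁⟩ := remainderEval_real_bounded (by linarith) hβroot hdig hx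
  have hC₂ : ∀ k, ‖remainderEval x α k‖ ≤ a * (1 - ‖α‖)⁻¹ := fun k => by
    rw [← norm_neg]
    exact norm_le_of_hasSum h1 (fun i => hdig (i + k)) (hasSum_remainderEval hroot h0 hx hsum k)
  obtain ⟨B, hB⟩ := coord_bounded_of_remainderEval_bounded hα hC₁ hC₂
  obtain ⟨C, hC⟩ := seqG_succ_sub_bounded hroot hα h1 hN hβα
  have hβ0 : 0 < β := by linarith
  have hev := eventually_remainder_mem_Icc ha (inv_mul_cancel₀ hβ0.ne') hC hx hgr
    (by omega) hB
  obtain ⟨K, hK⟩ := eventually_atTop.1 hev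
  -- Strictness, with `n ≥ 0`, rules out `1, 0, 0`, which would make the left side equal to `seqG a
  -- (k + 2)`.
  have hS : ∀ k, x (k + 2) * seqG a (k + 2) + (x (k + 4) - x (k + 3)) * seqG a (k + 1)
        + x (k + 3) * seqG a k < seqG a (k + 2) := by
    intro k
    rw [← sum_digits_eq_remainder hx k]
    have := hgr (k + 2)
    omega
  have hzero : ∀ k, x (k + (K + 2)) = 0 := by
    refine eq_zero_of_remainder_mem_Icc (t := β⁻¹) (by positivity) ?_
      (x := fun k => x (k + (K + 2))) (B := B) (fun k => hB _) ?_ ?_ ?_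
    · rw [inv_le_comm₀ hβ0 (by norm_num)]; norm_num; exact hβ
    · intro k
      have := (hK (k + (K + 2)) (by omega)).1
      simpa only [add_right_comm] using this
    · intro k
      have := (hK (k + (K + 2)) (by omega)).2
      simpa only [add_right_comm] using this
    · intro k e1 e2 e3
      have := hS (k + K)
      rw [show k + K + 2 = k + (K + 2) by ring, show k + K + 3 = k + 1 + (K + 2) by ring,
        show k + K + 4 = k + 2 + (K + 2) by ring, e1, e2, e3] at this
      simp at this
  have hz : ∀ k, K + 2 ≤ k → x k = 0 := fun k hk => by
    obtain ⟨j, rfl⟩ := Nat.exists_eq_add_of_le' hk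
    exact hzero j
  refine ⟨K + 2, fun k hk => ?_, ?_⟩
  · have := hx k
    rw [hz k hk, hz (k + 1) (by omega), hz (k + 2) (by omega), hz (k + 3) (by omega)] at this
    omega
  · have := sum_digits_eq_remainder hx K
    rw [hz (K + 2) le_rfl, hz (K + 3) (by omega), hz (K + 4) (by omega), hx0] at this
    linarith

/-! ### The lattice and the fractal -/

theorem sub_mem_latticeZα {α u v : ℂ} (hu : u ∈ latticeZα α) (hv : v ∈ latticeZα α) :
    u - v ∈ latticeZα α := by
  obtain ⟨m, l, rfl⟩ := hu
  obtain ⟨m', l', rfl⟩ := hv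
  exact ⟨m - m', l - l', by push_cast; ring⟩

theorem exists_sum_eq_lattice_add {a : ℤ} {α : ℂ}
    (hroot : α ^ 3 - (a : ℂ) * α ^ 2 + α - 1 = 0) (ε : ℕ → ℕ) (N : ℕ) :
    ∃ m l : ℤ, ∑ i ∈ Finset.range N, (ε i : ℂ) * α ^ (i + 2) =
      m + l * α + (∑ i ∈ Finset.range N, (ε i : ℤ) * seqG a i : ℤ) * α ^ 2 := by
  choose m l h using exists_pow_eq_lattice_add hroot
  refine ⟨∑ i ∈ Finset.range N, ε i * m i, ∑ i ∈ Finset.range N, ε i * l i, ?_⟩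
  push_cast
  rw [Finset.sum_mul, Finset.sum_mul, ← Finset.sum_add_distrib, ← Finset.sum_add_distrib]
  refine Finset.sum_congr rfl fun i _ => ?_
  rw [h i]
  ring

theorem finite_latticeZα_norm_le {α : ℂ} (hα : α.im ≠ 0) (R : ℝ) :
    {u | u ∈ latticeZα α ∧ ‖u‖ ≤ R}.Finite := by
  let b : ℤ := ⌈R / |α.im|⌉
  let c : ℤ := ⌈R + b * ‖α‖⌉
  refine (((Set.finite_Icc (-c) c).prod (Set.finite_Icc (-b) b)).image
    fun p : ℤ × ℤ => (p.1 : ℂ) + p.2 * α).subset ?_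
  rintro u ⟨⟨m, l, rfl⟩, hu⟩
  have hl : |(l : ℝ)| ≤ b := by
    refine le_trans ?_ (Int.le_ceil _)
    rw [le_div_iff₀ (abs_pos.2 hα), ← abs_mul]
    refine le_trans (le_of_eq ?_) ((Complex.abs_im_le_norm _).trans hu)
    simp
  have hm : |(m : ℝ)| ≤ c := by
    refine le_trans ?_ (Int.le_ceil _)
    have h1 : ‖(m : ℂ)‖ ≤ ‖(m : ℂ) + l * α‖ + ‖(l : ℂ) * α‖ := by
      simpa using norm_sub_le ((m : ℂ) + l * α) (l * α)
    rw [norm_mul, Complex.norm_intCast, Complex.norm_intCast] at h1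
    have h2 := mul_le_mul_of_nonneg_right hl (norm_nonneg α)
    linarith
  exact ⟨(m, l), ⟨abs_le.1 (by exact_mod_cast hm), abs_le.1 (by exact_mod_cast hl)⟩, rfl⟩

theorem isClosed_setOf_greedy (w : ℕ → ℤ) :
    IsClosed {ε : ℕ → ℕ | ∀ N, IsGreedyExpansion w N ε} := by
  simp only [IsGreedyExpansion, Set.ofPred_forall]
  refine isClosed_iInter fun N => isClosed_iInter fun k => isClosed_iInter fun _ => ?_
  refine (isClosed_discrete (Set.Iio (w (k + 1)))).preimage
    (f := fun ε : ℕ → ℕ => ∑ i ∈ Finset.range (k + 1), (ε i : ℤ) * w i) ?_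
  exact continuous_finsetSum _ fun i _ =>
    (continuous_of_discreteTopology (f := fun n : ℕ => (n : ℤ) * w i)).comp (continuous_apply i)

theorem isCompact_setOf_greedy {a : ℤ} (ha : 2 ≤ a) :
    IsCompact {ε : ℕ → ℕ | ∀ N, IsGreedyExpansion (seqG a) N ε} := by
  refine (isCompact_univ_pi fun _ : ℕ => (Set.finite_Iic a.toNat).isCompact).of_isClosed_subset
    (isClosed_setOf_greedy _) fun ε hε i _ => ?_
  have := (hε i).digit_lt ha
  simp only [Set.mem_Iic]
  omega

/-- The fractal is the image of the compact space of digit sequences under a uniformly convergent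
series. -/
theorem isClosed_gRauzyFractal {a : ℤ} (ha : 2 ≤ a) {α : ℂ} (h1 : ‖α‖ < 1) :
    IsClosed (gRauzyFractal a α) := by
  let K := {ε : ℕ → ℕ | ∀ N, IsGreedyExpansion (seqG a) N ε}
  have hgeo : Summable fun i : ℕ => (a : ℝ) * ‖α‖ ^ i :=
    (summable_geometric_of_lt_one (norm_nonneg α) h1).mul_left _
  have hbound : ∀ i, ∀ ε ∈ K, ‖(ε i : ℂ) * α ^ (i + 2)‖ ≤ a * ‖α‖ ^ i := by
    intro i ε hε
    have h2 : (ε i : ℝ) ≤ a := by exact_mod_cast ((hε i).digit_lt ha).le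
    rw [norm_mul, norm_pow, Complex.norm_natCast]
    gcongr ?_ * ?_
    · exact pow_le_pow_of_le_one (norm_nonneg α) h1.le (by omega)
  have himage : gRauzyFractal a α = (fun ε : ℕ → ℕ => ∑' i, (ε i : ℂ) * α ^ (i + 2)) '' K := by
    ext z
    constructor
    · rintro ⟨ε, hε, hz⟩
      exact ⟨ε, hε, hz.tsum_eq⟩
    · rintro ⟨ε, hε, rfl⟩
      exact ⟨ε, hε, (hgeo.of_norm_bounded fun i => hbound i ε hε).hasSum⟩
  rw [himage]
  refine ((isCompact_setOf_greedy ha).image_of_continuousOn ?_).isClosed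
  refine continuousOn_tsum (fun i => Continuous.continuousOn ?_) hgeo hbound
  exact (continuous_of_discreteTopology (f := fun n : ℕ => (n : ℂ) * α ^ (i + 2))).comp
    (continuous_apply i)

theorem isClosed_translateBy {S : Set ℂ} (hS : IsClosed S) (u : ℂ) :
    IsClosed (translateBy S u) :=
  (Homeomorph.addRight u).isClosedMap _ hS

theorem norm_le_of_mem_gRauzyFractal {a : ℤ} (ha : 2 ≤ a) {α z : ℂ} (h1 : ‖α‖ < 1)
    (hz : z ∈ gRauzyFractal a α) : ‖z‖ ≤ a * (1 - ‖α‖)⁻¹ := by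
  obtain ⟨ε, hε, h⟩ := hz
  exact norm_le_of_hasSum h1 (fun i => (hε i).digit_lt ha) h

theorem exists_mem_gRauzyFractal_lattice_add {a : ℤ} (ha : 2 ≤ a) {α : ℂ}
    (hroot : α ^ 3 - (a : ℂ) * α ^ 2 + α - 1 = 0) {n : ℤ} (hn : 0 ≤ n) :
    ∃ z ∈ gRauzyFractal a α, ∃ m l : ℤ, z = m + l * α + n * α ^ 2 := by
  have hlt : n < seqG a n.toNat := by
    have := natCast_lt_seqG ha n.toNat
    omega
  obtain ⟨ε, hε, hz, hs⟩ := exists_greedy rfl (strictMono_seqG ha) n.toNat n hn hlt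
  obtain ⟨m, l, h⟩ := exists_sum_eq_lattice_add hroot ε n.toNat
  rw [hs] at h
  refine ⟨_, ⟨ε, hε, hasSum_sum_of_ne_finset_zero (s := Finset.range n.toNat) ?_⟩, m, l, h⟩
  intro i hi
  rw [hz i (by simpa using hi)]
  simp

/-- The half `{m + l α + n α² : n ≥ 0}` of `ℤ[α]` is dense in the plane. -/
theorem exists_nonneg_lattice_near {a : ℤ} (ha : 2 ≤ a) {α : ℂ}
    (hroot : α ^ 3 - (a : ℂ) * α ^ 2 + α - 1 = 0) (hα : α.im ≠ 0) (p : ℂ) {δ : ℝ} (hδ : 0 < δ) :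
    ∃ n m l : ℤ, 0 ≤ n ∧ ‖p - (m + l * α + n * α ^ 2)‖ < δ := by
  have h1 := norm_root_lt_one ha hroot hα
  have h0 : α ≠ 0 := by rintro rfl; simp at hα
  obtain ⟨j, hj⟩ := exists_pow_lt_of_lt_one (by positivity : 0 < δ / 4) h1
  -- Expand `z` in the real basis `1, α` and round down; after multiplication by `α ^ (j + 2)` the
  -- error is at most `2 ‖α‖ ^ j`.
  set z := p / α ^ (j + 2) with hz
  set c := z.im / α.im with hc
  set b := z.re - c * α.re with hb
  have hzbc : z = b + c * α := by
    apply Complex.ext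
    · simp [hb]
    · simp [hc, hα]
  have hp : p = α ^ (j + 2) * z := by rw [hz]; field_simp
  obtain ⟨m₁, l₁, e₁⟩ := exists_pow_eq_lattice_add hroot j
  obtain ⟨m₂, l₂, e₂⟩ := exists_pow_eq_lattice_add hroot (j + 1)
  set N := ⌊b⌋ * seqG a j + ⌊c⌋ * seqG a (j + 1) with hN
  -- The `α²`-coordinate `N` may be negative. Adding `α ^ (k + 2)` repairs this, as `G_k > k ≥ |N|`,
  -- and costs at most `‖α‖ ^ j`.
  set k := max j N.natAbs with hk
  obtain ⟨m₃, l₃, e₃⟩ := exists_pow_eq_lattice_add hroot k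
  refine ⟨N + seqG a k, ⌊b⌋ * m₁ + ⌊c⌋ * m₂ + m₃, ⌊b⌋ * l₁ + ⌊c⌋ * l₂ + l₃, ?_, ?_⟩
  · have := natCast_lt_seqG ha k
    have : N.natAbs ≤ k := le_max_right _ _
    omega
  · have hsplit : p - (((⌊b⌋ * m₁ + ⌊c⌋ * m₂ + m₃ : ℤ) : ℂ)
        + ((⌊b⌋ * l₁ + ⌊c⌋ * l₂ + l₃ : ℤ) : ℂ) * α + ((N + seqG a k : ℤ) : ℂ) * α ^ 2) =
        α ^ (j + 2) * ((Int.fract b : ℝ) + (Int.fract c : ℝ) * α) - α ^ (k + 2) := by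
      rw [hp, hzbc, Int.fract, Int.fract, hN]
      push_cast
      linear_combination (⌊b⌋ : ℂ) * e₁ + (⌊c⌋ : ℂ) * e₂ + e₃
    rw [hsplit]
    have hj2 : ‖α ^ (j + 2)‖ ≤ ‖α‖ ^ j := by
      rw [norm_pow]; exact pow_le_pow_of_le_one (norm_nonneg α) h1.le (by omega)
    have hk2 : ‖α ^ (k + 2)‖ ≤ ‖α‖ ^ j := by
      rw [norm_pow]
      exact pow_le_pow_of_le_one (norm_nonneg α) h1.le
        ((le_max_left _ _).trans (Nat.le_add_right k 2))
    have hfr : ‖((Int.fract b : ℝ) : ℂ) + (Int.fract c : ℝ) * α‖ ≤ 1 + 1 * 1 := by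
      refine (norm_add_le _ _).trans ?_
      rw [norm_mul, Complex.norm_real, Complex.norm_real, Real.norm_eq_abs, Real.norm_eq_abs,
        Int.abs_fract, Int.abs_fract]
      gcongr
      · exact (Int.fract_lt_one b).le
      · exact (Int.fract_lt_one c).le
    refine (norm_sub_le _ _).trans_lt ?_
    rw [norm_mul]
    have := mul_le_mul hj2 hfr (norm_nonneg _) (by positivity)
    linarith

theorem iUnion_translateBy_gRauzyFractal {a : ℤ} (ha : 2 ≤ a) {α : ℂ}
    (hroot : α ^ 3 - (a : ℂ) * α ^ 2 + α - 1 = 0) (hα : α.im ≠ 0) :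
    (⋃ u ∈ latticeZα α, translateBy (gRauzyFractal a α) u) = Set.univ := by
  have h1 := norm_root_lt_one ha hroot hα
  refine Set.eq_univ_of_forall fun p => ?_
  set C := a * (1 - ‖α‖)⁻¹
  -- Only these finitely many tiles can come within distance `1` of `p`, and a finite union of
  -- closed tiles is closed.
  set F := {u | u ∈ latticeZα α ∧ ‖u‖ ≤ ‖p‖ + 1 + C}
  have hclosed : IsClosed (⋃ u ∈ F, translateBy (gRauzyFractal a α) u) :=
    (finite_latticeZα_norm_le hα _).isClosed_biUnion fun u _ =>
      isClosed_translateBy (isClosed_gRauzyFractal ha h1) u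
  have hp : p ∈ ⋃ u ∈ F, translateBy (gRauzyFractal a α) u := by
    rw [← hclosed.closure_eq, Metric.mem_closure_iff]
    intro δ hδ
    obtain ⟨n, m, l, hn, hnear⟩ :=
      exists_nonneg_lattice_near ha hroot hα p (lt_min hδ one_pos)
    obtain ⟨z, hz, m', l', rfl⟩ := exists_mem_gRauzyFractal_lattice_add ha hroot hn
    set q := (m : ℂ) + l * α + n * α ^ 2 with hq
    set u := ((m - m' : ℤ) : ℂ) + ((l - l' : ℤ) : ℂ) * α with hu
    have hqu : (m' : ℂ) + l' * α + n * α ^ 2 + u = q := by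
      rw [hq, hu]; push_cast; ring
    refine ⟨q, Set.mem_biUnion (x := u) ⟨⟨m - m', l - l', rfl⟩, ?_⟩ ⟨_, hz, hqu⟩, ?_⟩
    · have hzC := norm_le_of_mem_gRauzyFractal ha h1 hz
      have e : u = p - (p - q) - (m' + l' * α + n * α ^ 2) := by rw [← hqu]; ring
      rw [e]
      have h2 := norm_sub_le (p - (p - q)) ((m' : ℂ) + l' * α + n * α ^ 2)
      have h3 := norm_sub_le p (p - q)
      have h4 := hnear.trans_le (min_le_right _ _)
      linarith
    · rw [dist_eq_norm]
      exact hnear.trans_le (min_le_left _ _)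
  obtain ⟨u, hu, h⟩ := Set.mem_iUnion₂.1 hp
  exact Set.mem_biUnion hu.1 h

/-- The points with finite greedy expansion lie in no tile but their own. -/
theorem lattice_eq_zero_of_finite_mem_translateBy {a : ℤ} (ha : 2 ≤ a) {α : ℂ}
    (hroot : α ^ 3 - (a : ℂ) * α ^ 2 + α - 1 = 0) (hα : α.im ≠ 0) {ε : ℕ → ℕ}
    (hε : ∀ N, IsGreedyExpansion (seqG a) N ε) (N : ℕ) {u : ℂ} (hu : u ∈ latticeZα α)
    (h : ∑ i ∈ Finset.range N, (ε i : ℂ) * α ^ (i + 2) ∈ translateBy (gRauzyFractal a α) u) :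
    u = 0 := by
  obtain ⟨z, ⟨η, hη, hz⟩, hzu⟩ := h
  obtain ⟨m, l, hs⟩ := exists_sum_eq_lattice_add hroot ε N
  obtain ⟨m', l', rfl⟩ := hu
  have hpos := seqG_pos ha
  set n := ∑ i ∈ Finset.range N, (ε i : ℤ) * seqG a i with hn
  have hn0 : 0 ≤ n := Finset.sum_nonneg fun i _ => mul_nonneg (by positivity) (hpos i).le
  have hz' : z = n * α ^ 2 - ((m' - m : ℤ) : ℂ) - ((l' - l : ℤ) : ℂ) * α := by
    simp only at hzu
    push_cast
    linear_combination hzu + hs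
  obtain ⟨K, hK, hKsum⟩ := digits_finite_of_hasSum ha hroot hα hη hn0 (hz' ▸ hz)
  rw [isGreedyExpansion_forall_iff (hpos 0)] at hε hη
  set ζ : ℕ → ℕ := fun i => if i < N then ε i else 0 with hζ
  -- Stated for general `M` to serve both the weights in `ℤ` and the powers of `α` in `ℂ`.
  have hζsum : ∀ (M : Type) [AddCommMonoid M] (f : ℕ → ℕ → M), (∀ i, f i 0 = 0) →
      ∑ i ∈ Finset.range (max N K), f i (ζ i) = ∑ i ∈ Finset.range N, f i (ε i) := by
    intro M _ f hf
    rw [← Finset.sum_subset (Finset.range_subset_range.2 (le_max_left N K))]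
    · exact Finset.sum_congr rfl fun i hi => by simp [hζ, Finset.mem_range.1 hi]
    · intro i _ hi
      rw [Finset.mem_range] at hi
      simp [hζ, hi, hf]
  have hηsum : ∀ (M : Type) [AddCommMonoid M] (f : ℕ → ℕ → M), (∀ i, f i 0 = 0) →
      ∑ i ∈ Finset.range (max N K), f i (η i) = ∑ i ∈ Finset.range K, f i (η i) := by
    intro M _ f hf
    refine (Finset.sum_subset (Finset.range_subset_range.2 (le_max_right N K)) ?_).symm
    intro i _ hi
    rw [hK i (by simpa using hi), hf]
  have heq : ∀ i < max N K, ζ i = η i := by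
    refine greedy_unique (greedy_truncate (strictMono_seqG ha) (hpos 0) hε N) hη hpos _ ?_
    rw [hζsum ℤ (fun i d => (d : ℤ) * seqG a i) (by simp),
      hηsum ℤ (fun i d => (d : ℤ) * seqG a i) (by simp), hKsum]
  have hzsum : z = ∑ i ∈ Finset.range N, (ε i : ℂ) * α ^ (i + 2) := by
    refine hz.unique ?_
    rw [← hζsum ℂ (fun i d => (d : ℂ) * α ^ (i + 2)) (by simp)]
    rw [Finset.sum_congr rfl fun i hi => by rw [heq i (Finset.mem_range.1 hi)]]
    refine hasSum_sum_of_ne_finset_zero fun i hi => ?_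
    rw [hK i ((le_max_right N K).trans (by simpa using hi))]
    simp
  simp only [hzsum] at hzu
  simpa using hzu

theorem theorem3p1 (a : ℤ) (ha : 2 ≤ a) (α : ℂ)
    (hroot : α ^ 3 - (a : ℂ) * α ^ 2 + α - 1 = 0) (hα : α.im ≠ 0) :
    (⋃ u ∈ latticeZα α, translateBy (gRauzyFractal a α) u) = Set.univ ∧
    ∀ u ∈ latticeZα α, ∀ v ∈ latticeZα α,
      (interior (translateBy (gRauzyFractal a α) u) ∩
        translateBy (gRauzyFractal a α) v).Nonempty → u = v := by
  refine ⟨iUnion_translateBy_gRauzyFractal ha hroot hα, ?_⟩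
  rintro u hu v hv ⟨p, hpu, z, ⟨ε, hε, hz⟩, rfl⟩
  -- Openness of the interior allows the point to be replaced by a truncation of its expansion.
  have hlim := (hz.tendsto_sum_nat.add_const v).eventually (isOpen_interior.mem_nhds hpu)
  obtain ⟨N, hN⟩ := hlim.exists
  obtain ⟨y, hy, hyu⟩ := interior_subset hN
  refine sub_eq_zero.1 (lattice_eq_zero_of_finite_mem_translateBy ha hroot hα hε N
    (sub_mem_latticeZα hu hv) ⟨y, hy, ?_⟩)
  simp only at hyu ⊢
  linear_combination hyu
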